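/- Let $N,m\ge 1$ be integers and let $M=\mathbb T^N=\mathbb R^N/\mathbb Z^N$ be the flat torus, with the distance $|x-y|$ induced by the Euclidean distance of $\mathbb R^N$; let $\|v\|=\max_i|v_i|$ on $\mathbb R^m$. For $1\le i\le m$ let $H_i:M\times\mathbb R^N\times\mathbb R^m\to\mathbb R$, $(x,p,\mathbf u)\mapsto H_i(x,p,\mathbf u)$, satisfy: (H1) $H_i$ is of class $C^2$; (H2) $p\mapsto H_i(x,p,\mathbf u)$ is strictly convex for every $(x,\mathbf u)$; (H3) $H_i(x,p,\mathbf u)/|p|\to\infty$ as $|p|\to\infty$, for every $(x,\mathbf u)$; (H4) there is $\Theta_i>0$ with $|H_i(x,p,\mathbf u)-H_i(x,p,\mathbf v)|\le\Theta_i\|\mathbf u-\mathbf v\|$ for all $x,p,\mathbf u,\mathbf v$; (A) $H_i(x,p,\mathbf u)=h_i(x,p)+P_i(x,\mathbf u)$, and there are $0<a<1<A$, independent of $i$, such that $a|p|^2\le h_i(x,p)\le A|p|^2$ and $|\partial_xh_i(x,p)|\le A|p|^2$ for all $i,x,p$. Let $\varphi:M\to\mathbb R^m$ be continuous, and let $\mathbf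 u:M\times[0,\infty)\to\mathbb R^m$ be a (the unique) viscosity solution of the Cauchy problem $$\partial_tu_i+H_i(x,\partial_xu_i,\mathbf u)=0\ \text{ on } M\times(0,\infty),\qquad \mathbf u(\cdot,0)=\varphi,\qquad 1\le i\le m,$$ that is, $\mathbf u$ is continuous, $\mathbf u(\cdot,0)=\varphi$, and for every $i$, every $(x,t)$ with $t>0$ and every real function $\phi$ of class $C^1$ near $(x,t)$: if $u_i-\phi$ has a local maximum at $(x,t)$, then $\partial_t\phi(x,t)+H_i(x,\partial_x\phi(x,t),\mathbf u(x,t))\le0$; if $u_i-\phi$ has a local minimum at $(x,t)$, then $\partial_t\phi(x,t)+H_i(x,\partial_x\phi(x,t),\mathbf u(x,t))\ge0$. Then $\mathbf u$ is locally Lipschitz on $M\times(0,\infty)$: for every $(x_0,t_0)\in M\times(0,\infty)$ there are $r,\kappa>0$ such that $\|\mathbf u(x,t)-\mathbf u(y,s)\|\le\kappa(|x-y|+|t-s|)$ for all $(x,t),(y,s)\in M\times(0,\infty)$ with $|x-x_0|+|t-t_0|<r$ and $|y-x_0|+|s-t_0|<r$. -/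

import Mathlib

namespace WeaklyCoupledHJ

/-- Euclidean space `ℝ^N` with the Euclidean norm. -/
abbrev Euc (N : ℕ) : Type := EuclideanSpace ℝ (Fin N)

/-- The subgroup `ℤ^N` of `ℝ^N`. -/
def integerLattice (N : ℕ) : AddSubgroup (Euc N) where
  carrier := {v | ∀ j, ∃ k : ℤ, v j = k}
  zero_mem' := fun _ => ⟨0, by simp⟩
  add_mem' := by
    intro v w hv hw j
    obtain ⟨k, hk⟩ := hv j
    obtain ⟨l, hl⟩ := hw j
    exact ⟨k + l, by simp [hk, hl]⟩
  neg_mem' := by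
    intro v hv j
    obtain ⟨k, hk⟩ := hv j
    exact ⟨-k, by simp [hk]⟩

/-- The flat torus `𝕋^N = ℝ^N / ℤ^N`. Its topology is the quotient topology and its distance is
the one induced by the quotient of the Euclidean norm: `dist [v] [w] = inf_{k ∈ ℤ^N} |v - w + k|`.
Tangent and cotangent spaces are identified with `ℝ^N`. -/
abbrev Torus (N : ℕ) : Type := Euc N ⧸ integerLattice N

/-- The projection `ℝ^N → 𝕋^N`. Being a local isometry it serves as a chart around every point:
smoothness and derivatives in the space variable are computed after composing with it. -/
def proj {N : ℕ} (y : Euc N) : Torus N := QuotientAddGroup.mk y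

/-- A system of Hamiltonians `H_i(x, p, u)`, `x ∈ 𝕋^N`, `p ∈ ℝ^N`, `u ∈ ℝ^m`
(`Fin m → ℝ` carries the maximum norm). -/
abbrev Hamiltonians (N m : ℕ) : Type := Fin m → Torus N → Euc N → (Fin m → ℝ) → ℝ

/-- The standing assumptions on the Hamiltonians. -/
structure StandingAssumptions {N m : ℕ} (H : Hamiltonians N m) : Prop where
  /-- `H_i` is of class `C²` in `(x, p, u)`. -/
  contDiff : ∀ i, ContDiff ℝ 2
    (fun z : Euc N × Euc N × (Fin m → ℝ) => H i (proj z.1) z.2.1 z.2.2)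
  /-- `H_i` is strictly convex in `p`. -/
  strictConvex : ∀ i x u, StrictConvexOn ℝ Set.univ (fun p => H i x p u)
  /-- `H_i` is superlinear in `p`. -/
  superlinear : ∀ i x u,
    Filter.Tendsto (fun p => H i x p u / ‖p‖) (Bornology.cobounded (Euc N)) Filter.atTop
  /-- `H_i` is Lipschitz in `u`, uniformly in `(x, p)`. -/
  lipschitz : ∀ i, ∃ Θ : ℝ, 0 < Θ ∧ ∀ x p u v, |H i x p u - H i x p v| ≤ Θ * ‖u - v‖

/-- The model structure `H_i(x, p, u) = h_i(x, p) + P_i(x, u)` with `h_i` of quadratic growth. -/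
def ModelStructure {N m : ℕ} (H : Hamiltonians N m) : Prop :=
  ∃ (h : Fin m → Torus N → Euc N → ℝ) (P : Fin m → Torus N → (Fin m → ℝ) → ℝ) (a A : ℝ),
    0 < a ∧ a < 1 ∧ 1 < A ∧
    (∀ i x p u, H i x p u = h i x p + P i x u) ∧
    (∀ i x p, a * ‖p‖ ^ 2 ≤ h i x p ∧ h i x p ≤ A * ‖p‖ ^ 2) ∧
    (∀ i (y p : Euc N), ‖gradient (fun z => h i (proj z) p) y‖ ≤ A * ‖p‖ ^ 2)

/-- Viscosity subsolution of `∂_t u_i + H_i(x, ∂_x u_i, u) = 0`, `u(·, 0) = φ`. Only the values of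
`u` at times `t ≥ 0` matter. The test function `f` is given in the chart `proj`;
`ContDiffAt ℝ 1` says that it is `C¹` on a neighbourhood of the point. -/
structure IsViscositySubsolution {N m : ℕ} (H : Hamiltonians N m) (φ : Torus N → Fin m → ℝ)
    (u : Torus N → ℝ → Fin m → ℝ) : Prop where
  continuousOn : ContinuousOn (fun z : Torus N × ℝ => u z.1 z.2) (Set.univ ×ˢ Set.Ici 0)
  initial : ∀ i x, u x 0 i ≤ φ x i
  sub : ∀ i (y : Euc N) (t : ℝ), 0 < t → ∀ f : Euc N × ℝ → ℝ, ContDiffAt ℝ 1 f (y, t) →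
    IsLocalMax (fun z : Euc N × ℝ => u (proj z.1) z.2 i - f z) (y, t) →
    deriv (fun s => f (y, s)) t
      + H i (proj y) (gradient (fun z => f (z, t)) y) (u (proj y) t) ≤ 0

/-- Viscosity supersolution of `∂_t u_i + H_i(x, ∂_x u_i, u) = 0`, `u(·, 0) = φ`. -/
structure IsViscositySupersolution {N m : ℕ} (H : Hamiltonians N m) (φ : Torus N → Fin m → ℝ)
    (u : Torus N → ℝ → Fin m → ℝ) : Prop where
  continuousOn : ContinuousOn (fun z : Torus N × ℝ => u z.1 z.2) (Set.univ ×ˢ Set.Ici 0)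
  initial : ∀ i x, φ x i ≤ u x 0 i
  super : ∀ i (y : Euc N) (t : ℝ), 0 < t → ∀ f : Euc N × ℝ → ℝ, ContDiffAt ℝ 1 f (y, t) →
    IsLocalMin (fun z : Euc N × ℝ => u (proj z.1) z.2 i - f z) (y, t) →
    0 ≤ deriv (fun s => f (y, s)) t
      + H i (proj y) (gradient (fun z => f (z, t)) y) (u (proj y) t)

/-- Viscosity solution of the Cauchy problem. -/
def IsViscositySolution {N m : ℕ} (H : Hamiltonians N m) (φ : Torus N → Fin m → ℝ)
    (u : Torus N → ℝ → Fin m → ℝ) : Prop :=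
  IsViscositySubsolution H φ u ∧ IsViscositySupersolution H φ u

/-- Local Lipschitz continuity on `𝕋^N × (0, ∞)` for the distance `|x - y| + |t - s|`. -/
def IsLocallyLipschitz {N m : ℕ} (u : Torus N → ℝ → Fin m → ℝ) : Prop :=
  ∀ (x₀ : Torus N) (t₀ : ℝ), 0 < t₀ → ∃ r κ : ℝ, 0 < r ∧ 0 < κ ∧
    ∀ (x y : Torus N) (t s : ℝ), 0 < t → 0 < s →
      dist x x₀ + |t - t₀| < r → dist y x₀ + |s - t₀| < r →
      ‖u x t - u y s‖ ≤ κ * (dist x y + |t - s|)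

end WeaklyCoupledHJ

namespace WeaklyCoupledHJ

open Filter Topology Set

/-! Shift the solution so that all components are at least 1 and put `w_i = log (u_i + R + 1)`. With
`v = u_i + R + 1` and `q` the space gradient of `w_i`, the kinetic term in the equation for `w_i` is
`h_i(x, v q) / v`. Since `h_i(x, ·)` is convex and pinched between two multiples of `|p|²`, this
quotient increases with `v` at a rate of order `|q|²` (`scaling_gap_smul`). The logarithm thus
creates a monotonicity in the unknown that grows quadratically with the slope.

For the space estimate (`exists_log_lipschitz`), maximise `t(T-t)(w_i(x,t) - w_i(y,s)) - K|x-y| -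
(t-s)²/ε` over the index as well as the points (`exists_doubling_max`). The weight vanishes at both
ends, so no regularity of the initial datum enters. If the estimate fails, both viscosity
inequalities hold at the maximum with one common `q`, of length `Q = K/(t(T-t))`. With `D = w_i(x,t)
- w_i(y,s)`, subtracting them leaves a gain of order `Q² D`. The errors are at most of order `Q D`:
the `x`-dependence of `h_i` costs `Q²|x-y|` and `Q|x-y| ≤ D`, the derivative of the weight costs `Q
D`, and the coupling costs `D`, because the choice of the index controls all other components. Hence
`Q` is bounded (`slope_le`), which is absurd for large `K`.

Once slopes in space are bounded, so is the Hamiltonian along the solution, and a paraboloid rising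
faster than that bound cannot touch the solution from above (`le_add_of_not_isLocalMax`). This, with
its mirror image, gives the time estimate. -/

/-! ### Superlinear scaling of pinched convex functions -/

/-- A convex function pinched between `a|p|²` and `A|p|²` has a quantitative gap under
rescaling. -/
theorem scaling_gap {E : Type*} [NormedAddCommGroup E] [NormedSpace ℝ E] {f : E → ℝ} {a A : ℝ}
    (ha : 0 < a) (haA : a ≤ A) (hconv : ConvexOn ℝ univ f) (hlow : ∀ p, a * ‖p‖ ^ 2 ≤ f p)
    (hup : ∀ p, f p ≤ A * ‖p‖ ^ 2) {μ : ℝ} (hμ : 1 < μ) (p : E) :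
    a ^ 2 / (4 * A) * ‖p‖ ^ 2 * ((μ - 1) / μ) ≤ f (μ • p) / μ - f p := by
  have hA : 0 < A := ha.trans_le haA
  -- Write `p` as a convex combination of `μ • p` and `r • p`. For this `r`, the upper bound at `r •
  -- p` is `r * (a / 2) * ‖p‖ ^ 2`, half of `r` times the lower bound at `p`; the other half is the
  -- gap.
  obtain ⟨r, hr⟩ : ∃ r : ℝ, r = a / (2 * A) := ⟨_, rfl⟩
  have hr0 : 0 < r := by rw [hr]; positivity
  have hr1 : r ≤ 1 / 2 := by rw [hr, div_le_div_iff₀ (by positivity) (by norm_num)]; linarith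
  have hrA : A * r = a / 2 := by rw [hr]; field_simp
  have hμr : 0 < μ - r := by linarith
  obtain ⟨θ, hθ⟩ : ∃ θ : ℝ, θ = (1 - r) / (μ - r) := ⟨_, rfl⟩
  have hθ' : θ * (μ - r) = 1 - r := by rw [hθ]; field_simp
  have hθ0 : 0 < θ := by rw [hθ]; exact div_pos (by linarith) hμr
  have hθ1 : θ < 1 := by rw [hθ, div_lt_one hμr]; linarith
  have hc := hconv.2 (mem_univ (μ • p)) (mem_univ (r • p)) hθ0.le
    (sub_nonneg.2 hθ1.le) (by ring)
  have hpt : θ • μ • p + (1 - θ) • r • p = p := by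
    rw [smul_smul, smul_smul, ← add_smul]
    have : θ * μ + (1 - θ) * r = 1 := by linarith
    rw [this, one_smul]
  rw [hpt, smul_eq_mul, smul_eq_mul] at hc
  have hrp := hup (r • p)
  rw [norm_smul, Real.norm_of_nonneg hr0.le, mul_pow] at hrp
  have hlp := hlow p
  obtain ⟨n, hn⟩ : ∃ n : ℝ, n = ‖p‖ ^ 2 := ⟨_, rfl⟩
  have hn0 : 0 ≤ n := hn ▸ sq_nonneg _
  rw [← hn] at hrp hlp ⊢
  have hrp' : A * (r ^ 2 * n) = r * (a / 2) * n := by rw [← hrA]; ring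
  have h1 : θ * (μ - 1) ≤ 1 - θ := by nlinarith
  have hrc : a ^ 2 / (4 * A) = r * (a / 2) := by rw [hr]; field_simp; ring
  rw [hrc]
  have key : θ * (r * (a / 2) * n * (μ - 1)) ≤ θ * (f (μ • p) - μ * f p) := by
    have e1 : 1 - θ * μ = (1 - θ) * r := by linarith
    have e2 : (1 - θ) * f (r • p) ≤ (1 - θ) * (r * (a / 2) * n) :=
      mul_le_mul_of_nonneg_left (hrp.trans hrp'.le) (by linarith)
    have e3 : (1 - θ) * r * (a * n) ≤ (1 - θ) * r * f p :=
      mul_le_mul_of_nonneg_left hlp (mul_nonneg (by linarith) hr0.le)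
    have e4 : θ * (μ - 1) * (r * (a / 2) * n) ≤ (1 - θ) * (r * (a / 2) * n) :=
      mul_le_mul_of_nonneg_right h1 (by positivity)
    have e5 : f p - θ * μ * f p = (1 - θ) * r * f p := by rw [← e1]; ring
    nlinarith
  have key' := le_of_mul_le_mul_left key hθ0
  have hμ0 : 0 < μ := by linarith
  have : f (μ • p) / μ - f p = (f (μ • p) - μ * f p) / μ := by field_simp
  rw [this, ← mul_div_assoc]
  exact div_le_div_of_nonneg_right key' hμ0.le

/-- The scaling gap between two multiples of the same covector. -/
theorem scaling_gap_smul {E : Type*} [NormedAddCommGroup E] [NormedSpace ℝ E] {f : E → ℝ}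
    {a A : ℝ} (ha : 0 < a) (haA : a ≤ A) (hconv : ConvexOn ℝ univ f)
    (hlow : ∀ p, a * ‖p‖ ^ 2 ≤ f p) (hup : ∀ p, f p ≤ A * ‖p‖ ^ 2) {v v' : ℝ} (hv' : 0 < v')
    (hv : v' < v) (q : E) :
    a ^ 2 / (4 * A) * ‖q‖ ^ 2 * (v' * (v - v') / v) ≤ f (v • q) / v - f (v' • q) / v' := by
  have hμ : 1 < v / v' := (one_lt_div hv').2 hv
  have hv0 : 0 < v := hv'.trans hv
  have h := scaling_gap ha haA hconv hlow hup hμ (v' • q)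
  rw [smul_smul, div_mul_cancel₀ _ hv'.ne', norm_smul, Real.norm_of_nonneg hv'.le] at h
  have h' := div_le_div_of_nonneg_right h hv'.le
  calc _ = _ := ?_
    _ ≤ _ := h'
    _ = _ := ?_
  · field_simp
  · field_simp

/-! ### Gradients and exponential test functions -/

theorem hasGradientAt_norm_sub_sq {E : Type*} [NormedAddCommGroup E] [InnerProductSpace ℝ E]
    [CompleteSpace E] (x c : E) :
    HasGradientAt (fun z => ‖z - c‖ ^ 2) ((2 : ℝ) • (x - c)) x := by
  have h1 : HasFDerivAt (fun z : E => ‖z - c‖ ^ 2) _ x :=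
    ((hasFDerivAt_id x).sub_const c).norm_sq
  rw [hasGradientAt_iff_hasFDerivAt]
  refine h1.congr_fderiv (ContinuousLinearMap.ext fun z => ?_)
  simp [two_smul]

theorem hasGradientAt_norm_sub {E : Type*} [NormedAddCommGroup E] [InnerProductSpace ℝ E]
    [CompleteSpace E] {x c : E} (h : x ≠ c) :
    HasGradientAt (fun z => ‖z - c‖) (‖x - c‖⁻¹ • (x - c)) x := by
  have hne : ‖x - c‖ ≠ 0 := norm_ne_zero_iff.2 (sub_ne_zero.2 h)
  have h2 := (hasGradientAt_iff_hasFDerivAt.1 (hasGradientAt_norm_sub_sq x c)).sqrt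
    (pow_ne_zero 2 hne)
  simp only [Real.sqrt_sq (norm_nonneg _)] at h2
  rw [hasGradientAt_iff_hasFDerivAt]
  refine h2.congr_fderiv (ContinuousLinearMap.ext fun z => ?_)
  simp only [InnerProductSpace.toDual_apply_apply, inner_smul_left, smul_apply, smul_eq_mul,
    RCLike.conj_to_real]
  field_simp

theorem norm_inv_norm_smul_sub {E : Type*} [NormedAddCommGroup E] [NormedSpace ℝ E] {x c : E}
    (h : x ≠ c) : ‖‖x - c‖⁻¹ • (x - c)‖ = 1 := by
  rw [norm_smul, norm_inv, norm_norm, inv_mul_cancel₀ (norm_ne_zero_iff.2 (sub_ne_zero.2 h))]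

theorem hasGradientAt_const_mul {E : Type*} [NormedAddCommGroup E] [InnerProductSpace ℝ E]
    [CompleteSpace E] {f : E → ℝ} {g x : E} (h : HasGradientAt f g x) (c : ℝ) :
    HasGradientAt (fun z => c * f z) (c • g) x := by
  rw [hasGradientAt_iff_hasFDerivAt] at h ⊢
  simpa using h.const_mul c

theorem hasGradientAt_add_const {E : Type*} [NormedAddCommGroup E] [InnerProductSpace ℝ E]
    [CompleteSpace E] {f : E → ℝ} {g x : E} (h : HasGradientAt f g x) (c : ℝ) :
    HasGradientAt (fun z => f z + c) g x := by
  rw [hasGradientAt_iff_hasFDerivAt] at h ⊢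
  exact HasFDerivAt.add_const c h

theorem hasGradientAt_exp {E : Type*} [NormedAddCommGroup E] [InnerProductSpace ℝ E]
    [CompleteSpace E] {f : E → ℝ} {g x : E} (h : HasGradientAt f g x) :
    HasGradientAt (fun z => Real.exp (f z)) (Real.exp (f x) • g) x := by
  rw [hasGradientAt_iff_hasFDerivAt] at h ⊢
  simpa using HasFDerivAt.exp h

variable {N m : ℕ} {H : Hamiltonians N m} {φ : Torus N → Fin m → ℝ} {u : Torus N → ℝ → Fin m → ℝ}

/-- Testing a subsolution from above by an exponential. -/
theorem IsViscositySubsolution.exp_test (hu : IsViscositySubsolution H φ u) {i : Fin m}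
    {y : Euc N} {t : ℝ} (ht : 0 < t) (S : ℝ) {f : Euc N × ℝ → ℝ} (hf : ContDiffAt ℝ 1 f (y, t))
    (hloc : ∀ᶠ z in 𝓝 (y, t), u (proj z.1) z.2 i + S ≤
      (u (proj y) t i + S) * Real.exp (f z - f (y, t)))
    {b : ℝ} {q : Euc N} (hb : HasDerivAt (fun s => f (y, s)) b t)
    (hq : HasGradientAt (fun z => f (z, t)) q y) :
    (u (proj y) t i + S) * b + H i (proj y) ((u (proj y) t i + S) • q) (u (proj y) t) ≤ 0 := by
  obtain ⟨v, hv⟩ : ∃ v, v = u (proj y) t i + S := ⟨_, rfl⟩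
  rw [← hv] at hloc ⊢
  have h := hu.sub i y t ht (fun z => v * Real.exp (f z - f (y, t)))
    (contDiffAt_const.mul (hf.sub contDiffAt_const).exp) (by
      filter_upwards [hloc] with z hz
      simp only [sub_self, Real.exp_zero, mul_one]
      linarith)
  have hg := hasGradientAt_const_mul (hasGradientAt_exp (hasGradientAt_add_const hq (-f (y, t)))) v
  simp only [← sub_eq_add_neg, sub_self, Real.exp_zero, one_smul] at hg
  rw [HasGradientAt.gradient hg, ((hb.sub_const (f (y, t))).exp.const_mul v).deriv] at h
  simpa using h

/-- Testing a supersolution from below by an exponential. -/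
theorem IsViscositySupersolution.exp_test (hu : IsViscositySupersolution H φ u) {i : Fin m}
    {y : Euc N} {t : ℝ} (ht : 0 < t) (S : ℝ) {f : Euc N × ℝ → ℝ} (hf : ContDiffAt ℝ 1 f (y, t))
    (hloc : ∀ᶠ z in 𝓝 (y, t), (u (proj y) t i + S) * Real.exp (f z - f (y, t)) ≤
      u (proj z.1) z.2 i + S)
    {b : ℝ} {q : Euc N} (hb : HasDerivAt (fun s => f (y, s)) b t)
    (hq : HasGradientAt (fun z => f (z, t)) q y) :
    0 ≤ (u (proj y) t i + S) * b + H i (proj y) ((u (proj y) t i + S) • q) (u (proj y) t) := by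
  obtain ⟨v, hv⟩ : ∃ v, v = u (proj y) t i + S := ⟨_, rfl⟩
  rw [← hv] at hloc ⊢
  have h := hu.super i y t ht (fun z => v * Real.exp (f z - f (y, t)))
    (contDiffAt_const.mul (hf.sub contDiffAt_const).exp) (by
      filter_upwards [hloc] with z hz
      simp only [sub_self, Real.exp_zero, mul_one]
      linarith)
  have hg := hasGradientAt_const_mul (hasGradientAt_exp (hasGradientAt_add_const hq (-f (y, t)))) v
  simp only [← sub_eq_add_neg, sub_self, Real.exp_zero, one_smul] at hg
  rw [HasGradientAt.gradient hg, ((hb.sub_const (f (y, t))).exp.const_mul v).deriv] at h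
  simpa using h

/-! ### Doubling of variables on the torus -/

theorem proj_add_of_mem {k : Euc N} (hk : k ∈ integerLattice N) (y : Euc N) :
    proj (y + k) = proj y := by
  unfold proj
  rw [QuotientAddGroup.eq]
  simpa using (integerLattice N).neg_mem hk

theorem continuous_proj : Continuous (proj : Euc N → Torus N) := continuous_quotient_mk'

/-- Every point is congruent modulo `ℤ^N` to a point of the ball of radius `N`. -/
theorem exists_mem_integerLattice_norm_add_le (y : Euc N) :
    ∃ k ∈ integerLattice N, ‖y + k‖ ≤ N := by
  refine ⟨WithLp.toLp 2 fun j => -(⌊y j⌋ : ℝ), fun j => ⟨-⌊y j⌋, by simp⟩, ?_⟩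
  rw [EuclideanSpace.norm_eq, Real.sqrt_le_left (by positivity)]
  have : ∀ j ∈ Finset.univ, ‖(y + WithLp.toLp 2 fun j => -(⌊y j⌋ : ℝ) : Euc N) j‖ ^ 2 ≤ 1 := by
    intro j _
    have h0 := Int.floor_le (y j)
    have h1 := Int.lt_floor_add_one (y j)
    rw [Real.norm_eq_abs, sq_abs]
    simp only [PiLp.add_apply]
    nlinarith
  refine (Finset.sum_le_sum this).trans ?_
  simp only [Finset.sum_const, Finset.card_univ, Fintype.card_fin, nsmul_eq_mul, mul_one]
  have : N = 0 ∨ 1 ≤ N := by omega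
  rcases this with rfl | h
  · simp
  · have : (1 : ℝ) ≤ N := by exact_mod_cast h
    nlinarith

/-- Doubling of variables: if the weighted difference quotients of a periodic family `w` in the
space variable exceed `K` somewhere, then the doubled functional has a maximum point at which
`x ≠ y` and both times are interior. -/
theorem exists_doubling_max {N m : ℕ} {T W K : ℝ} {w : Fin m → Euc N → ℝ → ℝ} (hT : 0 < T)
    (hK : 1 ≤ K)
    (hc : ∀ i, ContinuousOn (fun z : Euc N × ℝ => w i z.1 z.2) (univ ×ˢ Icc 0 T))
    (hper : ∀ i, ∀ k ∈ integerLattice N, ∀ y t, w i (y + k) t = w i y t)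
    (hW : ∀ i x y, ∀ t ∈ Icc 0 T, ∀ s ∈ Icc 0 T, w i x t - w i y s ≤ W)
    {i₀ : Fin m} {x₀ y₀ : Euc N} {t₀ : ℝ} (ht₀ : t₀ ∈ Icc 0 T)
    (hpos : K * ‖x₀ - y₀‖ < t₀ * (T - t₀) * (w i₀ x₀ t₀ - w i₀ y₀ t₀)) :
    ∃ (i : Fin m) (x y : Euc N) (t s ε : ℝ), 0 < ε ∧ t ∈ Ioo 0 T ∧ s ∈ Ioo 0 T ∧ x ≠ y ∧
      ‖x‖ ≤ N + T ^ 2 * W + 1 ∧ ‖y‖ ≤ N + T ^ 2 * W + 1 ∧ 0 < w i x t - w i y s ∧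
      K * ‖x - y‖ + (t - s) ^ 2 / ε ≤ t * (T - t) * (w i x t - w i y s) ∧
      (∀ j, |w j x t - w j y s| ≤ 3 * (w i x t - w i y s)) ∧
      (∀ x', ∀ t' ∈ Icc 0 T,
        t' * (T - t') * (w i x' t' - w i y s) - (K * ‖x' - y‖ + (t' - s) ^ 2 / ε) ≤
          t * (T - t) * (w i x t - w i y s) - (K * ‖x - y‖ + (t - s) ^ 2 / ε)) ∧
      (∀ y', ∀ s' ∈ Icc 0 T,
        t * (T - t) * (w i x t - w i y' s') - (K * ‖x - y'‖ + (t - s') ^ 2 / ε) ≤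
          t * (T - t) * (w i x t - w i y s) - (K * ‖x - y‖ + (t - s) ^ 2 / ε)) := by
  obtain ⟨ρ, hρ⟩ : ∃ ρ : ℝ, ρ = N + T ^ 2 * W + 1 := ⟨_, rfl⟩
  rw [← hρ]
  have hτ0 : ∀ t ∈ Icc 0 T, 0 ≤ t * (T - t) := fun t ht =>
    mul_nonneg ht.1 (by linarith [ht.2])
  have hτT : ∀ t ∈ Icc 0 T, t * (T - t) ≤ T ^ 2 := fun t ht => by nlinarith [ht.1, ht.2]
  have hDpos : ∀ {t d : ℝ}, t ∈ Icc 0 T → 0 < t * (T - t) * d → 0 < d := fun ht h =>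
    (pos_iff_pos_of_mul_pos h).1 (lt_of_le_of_ne (hτ0 _ ht) fun h0 => by simp [← h0] at h)
  obtain ⟨M₀, hM₀⟩ : ∃ M₀ : ℝ,
    M₀ = t₀ * (T - t₀) * (w i₀ x₀ t₀ - w i₀ y₀ t₀) - K * ‖x₀ - y₀‖ := ⟨_, rfl⟩
  have hM₀pos : 0 < M₀ := by rw [hM₀]; linarith
  have hWpos : 0 < W := by
    refine lt_of_lt_of_le (hDpos ht₀ (lt_of_le_of_lt ?_ hpos)) (hW i₀ x₀ y₀ t₀ ht₀ t₀ ht₀)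
    positivity
  have hρ0 : 0 ≤ ρ := by rw [hρ]; positivity
  -- uniform continuity
  have hcpt : IsCompact (Metric.closedBall (0 : Euc N) ρ ×ˢ Icc (0 : ℝ) T) :=
    (isCompact_closedBall _ _).prod isCompact_Icc
  have hcw : ContinuousOn (fun (z : Euc N × ℝ) j => w j z.1 z.2)
      (Metric.closedBall (0 : Euc N) ρ ×ˢ Icc (0 : ℝ) T) :=
    continuousOn_pi.2 fun j => (hc j).mono (prod_mono (subset_univ _) subset_rfl)
  have huc := Metric.uniformContinuousOn_iff.1 (hcpt.uniformContinuousOn_of_continuous hcw)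
  -- At the maximum `D ≥ M₀ / T ^ 2`, so time shifts below `δ₁` change each `w j` by less than `D`.
  -- The second bound on `δ` will keep `s` inside `(0, T)`. A single small `ε` suffices; no limit is
  -- taken.
  obtain ⟨δ₁, hδ₁, hmod⟩ := huc (M₀ / T ^ 2) (by positivity)
  obtain ⟨δ, hδ, hδδ₁, hδM⟩ : ∃ δ > 0, δ ≤ δ₁ ∧ δ ≤ M₀ / (T * W) :=
    ⟨min δ₁ (M₀ / (T * W)), lt_min hδ₁ (by positivity), min_le_left _ _, min_le_right _ _⟩
  obtain ⟨ε, hε⟩ : ∃ ε : ℝ, ε = δ ^ 2 / (2 * (T ^ 2 * W)) := ⟨_, rfl⟩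
  have hε0 : 0 < ε := by rw [hε]; positivity
  -- maximum points on a compact set
  let G : Fin m → (Euc N × Euc N) × (ℝ × ℝ) → ℝ := fun j z =>
    z.2.1 * (T - z.2.1) * (w j z.1.1 z.2.1 - w j z.1.2 z.2.2)
      - (K * ‖z.1.1 - z.1.2‖ + (z.2.1 - z.2.2) ^ 2 / ε)
  let C : Set ((Euc N × Euc N) × (ℝ × ℝ)) :=
    (Metric.closedBall 0 ρ ×ˢ Metric.closedBall 0 ρ) ×ˢ (Icc 0 T ×ˢ Icc 0 T)
  have hC : IsCompact C := ((isCompact_closedBall _ _).prod (isCompact_closedBall _ _)).prod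
    (isCompact_Icc.prod isCompact_Icc)
  have hCne : C.Nonempty := ⟨((0, 0), (0, 0)), by simp [C, hρ0, hT.le]⟩
  have hGc : ∀ j, ContinuousOn (G j) C := by
    intro j
    have h1 : ContinuousOn (fun z : (Euc N × Euc N) × (ℝ × ℝ) => w j z.1.1 z.2.1) C :=
      (hc j).comp (f := fun z : (Euc N × Euc N) × (ℝ × ℝ) => (z.1.1, z.2.1))
        (by fun_prop) fun z hz => ⟨mem_univ _, hz.2.1⟩
    have h2 : ContinuousOn (fun z : (Euc N × Euc N) × (ℝ × ℝ) => w j z.1.2 z.2.2) C :=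
      (hc j).comp (f := fun z : (Euc N × Euc N) × (ℝ × ℝ) => (z.1.2, z.2.2))
        (by fun_prop) fun z hz => ⟨mem_univ _, hz.2.2⟩
    have h3 : Continuous fun z : (Euc N × Euc N) × (ℝ × ℝ) => z.2.1 * (T - z.2.1) := by
      fun_prop
    have h4 : Continuous fun z : (Euc N × Euc N) × (ℝ × ℝ) =>
      K * ‖z.1.1 - z.1.2‖ + (z.2.1 - z.2.2) ^ 2 / ε := by fun_prop
    exact (h3.continuousOn.mul (h1.sub h2)).sub h4.continuousOn
  choose Z hZC hZ using fun j => hC.exists_isMaxOn hCne (hGc j)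
  have : Nonempty (Fin m) := ⟨i₀⟩
  obtain ⟨i, hi⟩ := Finite.exists_max fun j => G j (Z j)
  have hmaxC : ∀ j, ∀ z ∈ C, G j z ≤ G i (Z i) := fun j z hz => (hZ j hz).trans (hi j)
  -- Where the functional is positive, the penalty bounds `‖x - y‖`; a common lattice shift then
  -- brings both points into the compact set.
  have hmax' : ∀ j x y, ∀ t ∈ Icc 0 T, ∀ s ∈ Icc 0 T,
      0 < G j ((x, y), (t, s)) → G j ((x, y), (t, s)) ≤ G i (Z i) := by
    intro j x y t ht s hs h
    obtain ⟨k, hk, hkx⟩ := exists_mem_integerLattice_norm_add_le x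
    have hshift : G j ((x, y), (t, s)) = G j ((x + k, y + k), (t, s)) := by
      simp only [G, hper j k hk, add_sub_add_right_eq_sub]
    rw [hshift]
    have hxy : ‖x - y‖ ≤ T ^ 2 * W + 1 := by
      by_contra! hcon
      have h1 : t * (T - t) * (w j x t - w j y s) ≤ T ^ 2 * W :=
        (mul_le_mul_of_nonneg_left (hW j x y t ht s hs) (hτ0 t ht)).trans
          (mul_le_mul_of_nonneg_right (hτT t ht) hWpos.le)
      have h2 : ‖x - y‖ ≤ K * ‖x - y‖ := le_mul_of_one_le_left (norm_nonneg _) hK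
      have h3 : 0 ≤ (t - s) ^ 2 / ε := by positivity
      simp only [G] at h
      linarith
    refine hmaxC j _ ⟨⟨?_, ?_⟩, ht, hs⟩
    · rw [mem_closedBall_zero_iff, hρ]
      have : 0 < T ^ 2 * W := by positivity
      show ‖x + k‖ ≤ _
      linarith
    · rw [mem_closedBall_zero_iff, hρ]
      have : ‖y + k‖ ≤ ‖x + k‖ + ‖x - y‖ := by
        have := norm_sub_le (x + k) (x - y)
        rwa [show x + k - (x - y) = y + k by abel] at this
      show ‖y + k‖ ≤ _
      linarith
  have hGM : M₀ ≤ G i (Z i) := by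
    have h : G i₀ ((x₀, y₀), (t₀, t₀)) = M₀ := by simp [G, hM₀]
    rw [← h]
    exact hmax' _ _ _ _ ht₀ _ ht₀ (by rw [h]; exact hM₀pos)
  have hmax : ∀ j x y, ∀ t ∈ Icc 0 T, ∀ s ∈ Icc 0 T,
      G j ((x, y), (t, s)) ≤ G i (Z i) := by
    intro j x y t ht s hs
    rcases lt_or_ge 0 (G j ((x, y), (t, s))) with h | h
    · exact hmax' j x y t ht s hs h
    · linarith
  obtain ⟨⟨⟨x, y⟩, t, s⟩, hZi⟩ : ∃ z, z = Z i := ⟨_, rfl⟩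
  have hmem := hZC i
  rw [← hZi] at hmem hGM hmax
  obtain ⟨⟨hx, hy⟩, ht, hs⟩ := hmem
  simp only [mem_closedBall_zero_iff] at hx hy
  obtain ⟨D, hD⟩ : ∃ D, D = w i x t - w i y s := ⟨_, rfl⟩
  have hGM' : M₀ ≤ t * (T - t) * D - (K * ‖x - y‖ + (t - s) ^ 2 / ε) := by rw [hD]; exact hGM
  have hpen1 : 0 ≤ K * ‖x - y‖ := by positivity
  have hpen2 : 0 ≤ (t - s) ^ 2 / ε := by positivity
  have hτD : M₀ ≤ t * (T - t) * D := by linarith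
  have hD0 : 0 < D := hDpos ht (hM₀pos.trans_le hτD)
  have hDW : D ≤ W := hD ▸ hW i x y t ht s hs
  have hDM : M₀ / T ^ 2 ≤ D := by
    rw [div_le_iff₀ (by positivity)]
    nlinarith [hτT t ht]
  have hts : |t - s| < δ := by
    refine abs_lt_of_sq_lt_sq ?_ hδ.le
    have h1 : (t - s) ^ 2 / ε ≤ T ^ 2 * W := by
      have h2 : t * (T - t) * D ≤ T ^ 2 * W :=
        mul_le_mul (hτT t ht) hDW hD0.le (by positivity)
      linarith
    rw [div_le_iff₀ hε0, hε] at h1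
    have : T ^ 2 * W * (δ ^ 2 / (2 * (T ^ 2 * W))) = δ ^ 2 / 2 := by field_simp
    rw [this] at h1
    have : 0 < δ ^ 2 := by positivity
    linarith
  -- The weight cannot be small at the maximum, so `t` and `T - t` are at least `δ`, and `|t - s| <
  -- δ` makes `s` interior too.
  have htlow : M₀ / (T * W) ≤ t * (T - t) / T := by
    rw [div_le_div_iff₀ (by positivity) hT]
    have : t * (T - t) * D ≤ t * (T - t) * W := mul_le_mul_of_nonneg_left hDW (hτ0 t ht)
    nlinarith
  have hlow1 : t * (T - t) / T ≤ t := by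
    rw [div_le_iff₀ hT]; nlinarith [ht.1]
  have hlow2 : t * (T - t) / T ≤ T - t := by
    rw [div_le_iff₀ hT]; nlinarith [ht.2]
  obtain ⟨hts1, hts2⟩ := abs_lt.1 hts
  have hmodj : ∀ j z, ‖z‖ ≤ ρ → |w j z t - w j z s| < D := by
    intro j z hz
    have h := hmod (z, t) ⟨mem_closedBall_zero_iff.2 hz, ht⟩ (z, s)
      ⟨mem_closedBall_zero_iff.2 hz, hs⟩ (by
        rw [Prod.dist_eq]
        simp only [dist_self, Real.dist_eq]
        exact max_lt hδ₁ (hts.trans_le hδδ₁))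
    refine lt_of_le_of_lt ?_ (h.trans_le hDM)
    exact dist_le_pi_dist (fun j => w j z t) (fun j => w j z s) j
  have hτpos : 0 < t * (T - t) :=
    (pos_iff_pos_of_mul_pos (hM₀pos.trans_le hτD)).2 hD0
  have hG : G i ((x, y), (t, s)) =
    t * (T - t) * D - (K * ‖x - y‖ + (t - s) ^ 2 / ε) := by rw [hD]
  refine ⟨i, x, y, t, s, ε, hε0, ⟨by linarith, by linarith⟩, ⟨by linarith, by linarith⟩, ?_,
    hx, hy, hD ▸ hD0, by rw [← hD]; linarith, ?_, fun x' t' ht' => hmax i x' y t' ht' s hs,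
    fun y' s' hs' => hmax i x y' t ht s' hs'⟩
  -- If `x = y`, then `D` would be a pure time oscillation, which is less than `D`.
  · rintro rfl
    have := (abs_lt.1 (hmodj i x hx)).2
    linarith
  -- Maximality bounds the difference above by `D`. For the lower bound, compare with the points `x`
  -- and `y` exchanged, then pay two time oscillations, each below `D`: hence the factor 3.
  · intro j
    rw [← hD]
    have h1 := hmax j x y t ht s hs
    have h2 := hmax j y x t ht s hs
    rw [hG] at h1 h2
    simp only [G] at h1 h2
    rw [norm_sub_rev y x] at h2
    have h1' : w j x t - w j y s ≤ D :=
      le_of_mul_le_mul_left (by linarith) hτpos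
    have h2' : w j y t - w j x s ≤ D :=
      le_of_mul_le_mul_left (by linarith) hτpos
    have h3 := abs_lt.1 (hmodj j x hx)
    have h4 := abs_lt.1 (hmodj j y hy)
    exact abs_le.2 ⟨by linarith [h3.1, h4.2, h3.2, h4.1], by linarith⟩

/-! ### Bounds on compact sets -/

/-- The Hamiltonians are bounded and Lipschitz in `(x, u)` on bounded sets. -/
theorem StandingAssumptions.exists_bound (hH : StandingAssumptions H) (ρ : ℝ) :
    ∃ L : ℝ, 0 ≤ L ∧ ∀ i (x y p : Euc N) (a b : Fin m → ℝ), ‖x‖ ≤ ρ → ‖y‖ ≤ ρ → ‖p‖ ≤ ρ →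
      ‖a‖ ≤ ρ → ‖b‖ ≤ ρ →
      |H i (proj x) p a - H i (proj y) p b| ≤ L * (‖x - y‖ + ‖a - b‖) ∧
      |H i (proj x) p a| ≤ L := by
  let C : Set (Euc N × Euc N × (Fin m → ℝ)) :=
    Metric.closedBall 0 ρ ×ˢ (Metric.closedBall 0 ρ ×ˢ Metric.closedBall 0 ρ)
  have hC : IsCompact C :=
    (isCompact_closedBall _ _).prod ((isCompact_closedBall _ _).prod (isCompact_closedBall _ _))
  have hCc : Convex ℝ C :=
    (convex_closedBall _ _).prod ((convex_closedBall _ _).prod (convex_closedBall _ _))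
  choose k hk using fun i =>
    (hH.contDiff i).contDiffOn.exists_lipschitzOnWith two_ne_zero hCc hC
  choose B hB using fun i => hC.exists_bound_of_continuousOn (hH.contDiff i).continuous.continuousOn
  refine ⟨∑ i, ((k i : ℝ) + |B i|), Finset.sum_nonneg fun i _ => by positivity, ?_⟩
  intro i x y p a b hx hy hp ha hb
  have hle : (k i : ℝ) + |B i| ≤ ∑ i, ((k i : ℝ) + |B i|) :=
    Finset.single_le_sum (f := fun i => (k i : ℝ) + |B i|) (fun i _ => by positivity)
      (Finset.mem_univ i)
  have hxC : (x, p, a) ∈ C := by simp [C, hx, hp, ha]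
  have hyC : (y, p, b) ∈ C := by simp [C, hy, hp, hb]
  have h0 : (0 : ℝ) ≤ k i := (k i).2
  refine ⟨?_, (hB i _ hxC).trans (by linarith [le_abs_self (B i)])⟩
  have h := (hk i).dist_le_mul _ hxC _ hyC
  rw [Real.dist_eq] at h
  refine h.trans ?_
  have hd : dist (x, p, a) (y, p, b) ≤ ‖x - y‖ + ‖a - b‖ := by
    simp only [Prod.dist_eq, dist_self]
    rw [dist_eq_norm, dist_eq_norm]
    have := norm_nonneg (x - y)
    have := norm_nonneg (a - b)
    refine max_le (by linarith) (max_le (by linarith) (by linarith))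
  exact mul_le_mul (by linarith [abs_nonneg (B i)]) hd dist_nonneg (h0.trans (by
    linarith [abs_nonneg (B i)]))

theorem continuousOn_lift
    (hu : ContinuousOn (fun z : Torus N × ℝ => u z.1 z.2) (univ ×ˢ Ici 0)) :
    ContinuousOn (fun z : Euc N × ℝ => u (proj z.1) z.2) (univ ×ˢ Ici 0) :=
  hu.comp (f := fun z : Euc N × ℝ => (proj z.1, z.2))
    ((continuous_proj.comp continuous_fst).prodMk continuous_snd).continuousOn
    fun _ hz => ⟨mem_univ _, hz.2⟩

theorem exists_norm_le (hu : ContinuousOn (fun z : Torus N × ℝ => u z.1 z.2) (univ ×ˢ Ici 0))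
    (T : ℝ) : ∃ R : ℝ, 0 ≤ R ∧ ∀ y : Euc N, ∀ t ∈ Icc 0 T, ‖u (proj y) t‖ ≤ R := by
  have hcpt : IsCompact (Metric.closedBall (0 : Euc N) N ×ˢ Icc (0 : ℝ) T) :=
    (isCompact_closedBall _ _).prod isCompact_Icc
  obtain ⟨R, hR⟩ := hcpt.exists_bound_of_continuousOn
    ((continuousOn_lift hu).mono (prod_mono (subset_univ _) Icc_subset_Ici_self))
  refine ⟨|R|, abs_nonneg _, fun y t ht => ?_⟩
  obtain ⟨k, hk, hy⟩ := exists_mem_integerLattice_norm_add_le y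
  have := hR (y + k, t) ⟨mem_closedBall_zero_iff.2 hy, ht⟩
  rw [proj_add_of_mem hk] at this
  exact this.trans (le_abs_self R)

/-! ### Lipschitz estimate in space -/

theorem sub_le_mul_log_sub {v v' V : ℝ} (hv' : 1 ≤ v') (hv : v' ≤ v) (hV : v ≤ V) :
    v - v' ≤ V * (Real.log v - Real.log v') := by
  have hv'0 : 0 < v' := by linarith
  have hv0 : 0 < v := by linarith
  have hlog : Real.log v - Real.log v' = -Real.log (v' / v) := by
    rw [Real.log_div hv'0.ne' hv0.ne']; ring
  have h1 := Real.log_le_sub_one_of_pos (div_pos hv'0 hv0)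
  have h2 : 1 - v' / v ≤ Real.log v - Real.log v' := by rw [hlog]; linarith
  have h3 : v * (1 - v' / v) = v - v' := by field_simp
  have h4 : 0 ≤ 1 - v' / v := sub_nonneg.2 ((div_le_one hv0).2 hv)
  calc v - v' = v * (1 - v' / v) := h3.symm
    _ ≤ V * (1 - v' / v) := mul_le_mul_of_nonneg_right hV h4
    _ ≤ _ := mul_le_mul_of_nonneg_left h2 (by linarith)

theorem abs_sub_le_mul_abs_log_sub {v v' V : ℝ} (hv' : 1 ≤ v') (hv : 1 ≤ v) (hV : v ≤ V)
    (hV' : v' ≤ V) : |v - v'| ≤ V * |Real.log v - Real.log v'| := by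
  have hV0 : 0 ≤ V := by linarith
  rcases le_total v' v with h | h
  · rw [abs_of_nonneg (sub_nonneg.2 h)]
    exact (sub_le_mul_log_sub hv' h hV).trans (mul_le_mul_of_nonneg_left (le_abs_self _) hV0)
  · rw [abs_sub_comm, abs_of_nonneg (sub_nonneg.2 h), abs_sub_comm]
    exact (sub_le_mul_log_sub hv h hV').trans (mul_le_mul_of_nonneg_left (le_abs_self _) hV0)

/-- The arithmetic of the doubling argument: the slope `Q` of the penalisation is bounded. -/
theorem slope_le {v v' V D Q r α b c A T L f g g' P P' : ℝ} (hv' : 1 ≤ v') (hv : v' < v)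
    (hV : v ≤ V) (hD : D = Real.log v - Real.log v') (hD0 : 0 < D) (hQ : 1 ≤ Q) (hc : 0 < c)
    (hA : 0 ≤ A) (hL : 0 ≤ L) (hr : 0 ≤ r) (hQr : Q * r ≤ D) (hα : -(T * Q * D) ≤ α)
    (hsub : v * (α + b) + (f + P) ≤ 0) (hsup : 0 ≤ v' * b + (g' + P'))
    (hgap : c * Q ^ 2 * (v' * (v - v') / v) ≤ f / v - g / v')
    (hlip : |g - g'| ≤ A * (v' * Q) ^ 2 * r) (hPP : |P - P'| ≤ L * (r + V * (3 * D)))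
    (hP' : |P'| ≤ L) :
    Q ≤ V * (A * V + T + L * (1 + 4 * V)) / c := by
  have hv'0 : 0 < v' := by linarith
  have hv0 : 0 < v := by linarith
  have hV0 : 0 < V := by linarith
  have hQ0 : 0 < Q := by linarith
  have hrD : r ≤ D := (le_mul_of_one_le_left hr hQ).trans hQr
  have hvD : v - v' ≤ V * D := hD ▸ sub_le_mul_log_sub hv' hv.le hV
  -- Dividing by `v` and `v'` turns these into inequalities for the logarithm; the common term `b`
  -- from the time penalty cancels in their difference.
  have hsub' : α + b + (f / v + P / v) ≤ 0 := by
    have : (v * (α + b) + (f + P)) / v ≤ 0 := div_nonpos_of_nonpos_of_nonneg hsub hv0.le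
    have e : (v * (α + b) + (f + P)) / v = α + b + (f / v + P / v) := by field_simp
    rwa [e] at this
  have hsup' : 0 ≤ b + (g' / v' + P' / v') := by
    have : 0 ≤ (v' * b + (g' + P')) / v' := div_nonneg hsup hv'0.le
    have e : (v' * b + (g' + P')) / v' = b + (g' / v' + P' / v') := by field_simp
    rwa [e] at this
  have hgap' : c * Q ^ 2 * (D / V) ≤ c * Q ^ 2 * (v' * (v - v') / v) := by
    refine mul_le_mul_of_nonneg_left ?_ (by positivity)
    have h1 : D ≤ v / v' - 1 := by
      rw [hD, ← Real.log_div hv0.ne' hv'0.ne']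
      exact Real.log_le_sub_one_of_pos (by positivity)
    have h2 : v' * D ≤ v - v' := by
      have := mul_le_mul_of_nonneg_left h1 hv'0.le
      rwa [mul_sub, mul_one, mul_div_cancel₀ _ hv'0.ne'] at this
    have h3 : D ≤ v' * (v - v') :=
      ((le_mul_of_one_le_left hD0.le hv').trans h2).trans
        (le_mul_of_one_le_left (by linarith) hv')
    exact div_le_div₀ (mul_nonneg hv'0.le (by linarith)) h3 hv0 hV
  -- The bound on `g - g'` is quadratic in `Q`, but one factor `Q` is absorbed by `Q * r ≤ D`.
  have hx : (g' - g) / v' ≤ A * V * Q * D := by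
    rw [div_le_iff₀ hv'0]
    have h1 : A * (v' * Q) ^ 2 * r = A * v' * Q * (Q * r) * v' := by ring
    have h2 : A * v' * Q * (Q * r) ≤ A * V * Q * D := by
      refine mul_le_mul ?_ hQr (by positivity) (by positivity)
      gcongr
      linarith
    calc g' - g ≤ |g - g'| := by rw [abs_sub_comm]; exact le_abs_self _
      _ ≤ _ := hlip
      _ = _ := h1
      _ ≤ _ := mul_le_mul_of_nonneg_right h2 hv'0.le
  have hPv : P' / v' - P / v ≤ L * (1 + 4 * V) * D := by
    have e : P' / v' - P / v = (P' - P) / v + P' * ((v - v') / (v * v')) := by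
      field_simp; ring
    have h1 : (P' - P) / v ≤ L * (r + V * (3 * D)) := by
      rw [div_le_iff₀ hv0]
      have h2 : P' - P ≤ |P - P'| := by rw [abs_sub_comm]; exact le_abs_self _
      have h3 : 0 ≤ L * (r + V * (3 * D)) := by positivity
      exact (h2.trans hPP).trans (le_mul_of_one_le_right h3 (by linarith))
    have h2 : P' * ((v - v') / (v * v')) ≤ L * (V * D) := by
      have h3 : 0 ≤ (v - v') / (v * v') := div_nonneg (by linarith) (by positivity)
      have h4 : (v - v') / (v * v') ≤ V * D :=
        (div_le_self (by linarith) (by nlinarith)).trans hvD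
      exact mul_le_mul ((le_abs_self _).trans hP') h4 h3 hL
    rw [e]
    have h5 : L * r ≤ L * D := mul_le_mul_of_nonneg_left hrD hL
    linarith
  have hx' : (g' - g) / v' = g' / v' - g / v' := sub_div _ _ _
  -- Every term carries the factor `D`; after cancelling it, a quadratic in `Q` is bounded by an
  -- affine function of `Q`.
  have key : c * Q ^ 2 * (D / V) ≤ (A * V * Q + T * Q + L * (1 + 4 * V)) * D := by
    have : (A * V * Q + T * Q + L * (1 + 4 * V)) * D =
      A * V * Q * D + T * Q * D + L * (1 + 4 * V) * D := by ring
    linarith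
  have key2 : c * Q ^ 2 / V ≤ A * V * Q + T * Q + L * (1 + 4 * V) := by
    refine le_of_mul_le_mul_right ?_ hD0
    calc c * Q ^ 2 / V * D = c * Q ^ 2 * (D / V) := by ring
      _ ≤ _ := key
  have key3 : c * Q / V * Q ≤ (A * V + T + L * (1 + 4 * V)) * Q := by
    have h1 : L * (1 + 4 * V) ≤ L * (1 + 4 * V) * Q := le_mul_of_one_le_right (by positivity) hQ
    calc c * Q / V * Q = c * Q ^ 2 / V := by ring
      _ ≤ _ := key2
      _ ≤ _ := by linarith
  have key4 := le_of_mul_le_mul_right key3 hQ0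
  rw [div_le_iff₀ hV0] at key4
  rw [le_div_iff₀ hc]
  linarith

/-- The gradient bound in `x` makes the kinetic part Lipschitz in `x`. -/
theorem abs_kinetic_sub_le (hH : StandingAssumptions H) {h : Fin m → Torus N → Euc N → ℝ}
    {P : Fin m → Torus N → (Fin m → ℝ) → ℝ} {A : ℝ}
    (hHP : ∀ i x p u, H i x p u = h i x p + P i x u) (h0 : ∀ i x, h i x 0 = 0)
    (hgrad : ∀ i (y p : Euc N), ‖gradient (fun z => h i (proj z) p) y‖ ≤ A * ‖p‖ ^ 2)
    (i : Fin m) (x y p : Euc N) :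
    |h i (proj x) p - h i (proj y) p| ≤ A * ‖p‖ ^ 2 * ‖x - y‖ := by
  -- `gradient` is 0 by default where differentiability fails, so the gradient bound alone gives
  -- nothing. Differentiability of `h i` in `x` is inherited from `H i`.
  have heq : (fun z => h i (proj z) p) = fun z => H i (proj z) p 0 - H i (proj z) 0 0 := by
    funext z
    rw [hHP, hHP, h0]
    ring
  have hd : Differentiable ℝ fun z : Euc N => h i (proj z) p := by
    rw [heq]
    have h1 : Differentiable ℝ fun z : Euc N => H i (proj z) p 0 :=
      ((hH.contDiff i).differentiable two_ne_zero).comp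
        (f := fun z : Euc N => (z, p, (0 : Fin m → ℝ))) (by fun_prop)
    have h2 : Differentiable ℝ fun z : Euc N => H i (proj z) 0 0 :=
      ((hH.contDiff i).differentiable two_ne_zero).comp
        (f := fun z : Euc N => (z, (0 : Euc N), (0 : Fin m → ℝ))) (by fun_prop)
    exact h1.sub h2
  refine Convex.norm_image_sub_le_of_norm_fderiv_le (𝕜 := ℝ) (s := univ)
    (fun z _ => hd z) (fun z _ => ?_) convex_univ (mem_univ y) (mem_univ x)
  rw [← toDual_gradient, LinearIsometryEquiv.norm_map]
  exact hgrad i z p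

/-- The derivative in time of the penalisation. -/
theorem hasDerivAt_penalty {T t s ε k : ℝ} (hτ : t * (T - t) ≠ 0) :
    HasDerivAt (fun t => (k + (t - s) ^ 2 / ε) / (t * (T - t)))
      (-((k + (t - s) ^ 2 / ε) * (T - 2 * t) / (t * (T - t)) ^ 2)
        + 2 * (t - s) / ε / (t * (T - t))) t := by
  have h1 : HasDerivAt (fun t : ℝ => k + (t - s) ^ 2 / ε) (2 * (t - s) / ε) t := by
    simpa using ((((hasDerivAt_id t).sub_const s).pow 2).div_const ε).const_add k
  have h2 : HasDerivAt (fun t : ℝ => t * (T - t)) (T - 2 * t) t := by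
    have := (hasDerivAt_id t).mul ((hasDerivAt_id t).const_sub T)
    simp only [id] at this
    exact this.congr_deriv (by ring)
  refine (h1.div h2 hτ).congr_deriv ?_
  field_simp
  ring

/-- Weighted Lipschitz estimate in the space variable, for the logarithm of a positive shift of
the solution. -/
theorem exists_log_lipschitz (hH : StandingAssumptions H) (hA : ModelStructure H)
    (hu : IsViscositySolution H φ u) {T R : ℝ} (hT : 0 < T) (hR0 : 0 ≤ R)
    (hR : ∀ y : Euc N, ∀ t ∈ Icc 0 T, ‖u (proj y) t‖ ≤ R) :
    ∃ K : ℝ, 0 ≤ K ∧ ∀ i (x y : Euc N), ∀ t ∈ Icc 0 T,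
      t * (T - t) * (Real.log (u (proj x) t i + (R + 1)) - Real.log (u (proj y) t i + (R + 1)))
        ≤ K * ‖x - y‖ := by
  obtain ⟨h, P, a, A, ha, ha1, hA1, hHP, hq, hgrad⟩ := hA
  have h0 : ∀ i x, h i x 0 = 0 := fun i x => by
    have := hq i x 0
    simp only [norm_zero] at this
    linarith [this.1, this.2]
  -- Pinching forces `h i x 0 = 0`, so `P i` inherits bounds and local Lipschitz continuity from `H
  -- i` at `p = 0`.
  have hP : ∀ i x b, P i x b = H i x 0 b := fun i x b => by rw [hHP, h0, zero_add]
  have hconv : ∀ i x, ConvexOn ℝ univ (h i x) := fun i x => by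
    have h1 := ((hH.strictConvex i x 0).convexOn).add_const (-P i x 0)
    refine h1.congr fun p _ => ?_
    simp [hHP]
  have hlip := abs_kinetic_sub_le hH hHP h0 hgrad
  obtain ⟨V, hV⟩ : ∃ V : ℝ, V = 2 * R + 1 := ⟨_, rfl⟩
  have hV1 : 1 ≤ V := by linarith
  have hcomp : ∀ i y, ∀ t ∈ Icc 0 T, 1 ≤ u (proj y) t i + (R + 1) ∧
      u (proj y) t i + (R + 1) ≤ V := fun i y t ht => by
    have h1 := (norm_le_pi_norm (u (proj y) t) i).trans (hR y t ht)
    rw [Real.norm_eq_abs, abs_le] at h1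
    constructor <;> linarith [h1.1, h1.2]
  obtain ⟨L, hL0, hL⟩ := hH.exists_bound (max (N + T ^ 2 * V + 1) R)
  obtain ⟨c, hc⟩ : ∃ c : ℝ, c = a ^ 2 / (4 * A) := ⟨_, rfl⟩
  have hA0 : 0 < A := by linarith
  have hc0 : 0 < c := by rw [hc]; positivity
  obtain ⟨B, hB⟩ : ∃ B : ℝ, B = V * (A * V + T + L * (1 + 4 * V)) / c := ⟨_, rfl⟩
  have hB0 : 0 ≤ B := by rw [hB]; positivity
  -- As the weight is at most `T ^ 2`, this forces the slope `K / τ` to be at least `B + 1`, whereas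
  -- `slope_le` will bound it by `B`.
  obtain ⟨K, hK⟩ : ∃ K : ℝ, K = 1 + T ^ 2 * (B + 1) := ⟨_, rfl⟩
  have hK1 : 1 ≤ K := by rw [hK]; linarith [show 0 ≤ T ^ 2 * (B + 1) by positivity]
  refine ⟨K, by linarith, fun i₀ x₀ y₀ t₀ ht₀ => ?_⟩
  by_contra! hcon
  obtain ⟨w, hw⟩ : ∃ w : Fin m → Euc N → ℝ → ℝ,
    w = fun i y t => Real.log (u (proj y) t i + (R + 1)) := ⟨_, rfl⟩
  have hcw : ∀ i, ContinuousOn (fun z : Euc N × ℝ => w i z.1 z.2) (univ ×ˢ Icc 0 T) := by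
    intro i
    rw [hw]
    have h1 : ContinuousOn (fun z : Euc N × ℝ => u (proj z.1) z.2 i + (R + 1))
        (univ ×ˢ Icc 0 T) :=
      ((continuousOn_pi.1 (continuousOn_lift hu.1.continuousOn) i).mono
        (prod_mono subset_rfl Icc_subset_Ici_self)).add continuousOn_const
    exact h1.log fun z hz => by linarith [(hcomp i z.1 z.2 hz.2).1]
  obtain ⟨i, x, y, t, s, ε, hε, ht, hs, hxy, hx, hy, hD0, hpen, hj, hmx, hmy⟩ :=
    exists_doubling_max (w := w) (W := V) (i₀ := i₀) (x₀ := x₀) (y₀ := y₀) hT hK1 hcw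
      (fun i k hk y t => by simp only [hw, proj_add_of_mem hk])
      (fun i x y t ht s hs => by
        rw [hw]
        have h1 := Real.log_le_sub_one_of_pos
          (show 0 < u (proj x) t i + (R + 1) by linarith [(hcomp i x t ht).1])
        have h2 := Real.log_nonneg (hcomp i y s hs).1
        have h3 := (hcomp i x t ht).2
        dsimp only
        linarith) ht₀ (by rw [hw]; exact hcon)
  have ht' := Ioo_subset_Icc_self ht
  have hs' := Ioo_subset_Icc_self hs
  obtain ⟨τ, hτ⟩ : ∃ τ : ℝ, τ = t * (T - t) := ⟨_, rfl⟩
  have hτ0 : 0 < τ := by rw [hτ]; exact mul_pos ht.1 (by linarith [ht.2])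
  have hτT : τ ≤ T ^ 2 := by rw [hτ]; nlinarith [ht.1, ht.2]
  obtain ⟨q, hqe⟩ : ∃ q : Euc N, q = (K / τ) • (‖x - y‖⁻¹ • (x - y)) := ⟨_, rfl⟩
  have hqn : ‖q‖ = K / τ := by
    rw [hqe, norm_smul, norm_inv_norm_smul_sub hxy, mul_one, Real.norm_of_nonneg]
    positivity
  have hQ : B + 1 ≤ K / τ := by
    rw [le_div_iff₀ hτ0, hK]
    have : (B + 1) * τ ≤ (B + 1) * T ^ 2 := mul_le_mul_of_nonneg_left hτT (by linarith)
    linarith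
  obtain ⟨v, hv⟩ : ∃ v, v = u (proj x) t i + (R + 1) := ⟨_, rfl⟩
  obtain ⟨v', hv'⟩ : ∃ v', v' = u (proj y) s i + (R + 1) := ⟨_, rfl⟩
  have hvb : 1 ≤ v ∧ v ≤ V := hv ▸ hcomp i x t ht'
  have hvb' : 1 ≤ v' ∧ v' ≤ V := hv' ▸ hcomp i y s hs'
  have hwx : w i x t = Real.log v := by rw [hw, hv]
  have hwy : w i y s = Real.log v' := by rw [hw, hv']
  have hlog : ∀ i y, ∀ t ∈ Icc 0 T, Real.exp (w i y t) = u (proj y) t i + (R + 1) :=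
    fun i y t ht => by rw [hw]; exact Real.exp_log (by linarith [(hcomp i y t ht).1])
  have hvv' : v' < v := by
    rw [hwx, hwy] at hD0
    exact (Real.log_lt_log_iff (by linarith) (by linarith)).1 (by linarith)
  -- the two viscosity inequalities
  obtain ⟨D, hD⟩ : ∃ D, D = w i x t - w i y s := ⟨_, rfl⟩
  -- Including the maximal value `G` in the numerator makes the test function, after division by the
  -- weight, touch `w i - w i y s` from above at `(x, t)`.
  obtain ⟨G, hG⟩ : ∃ G, G = τ * D - (K * ‖x - y‖ + (t - s) ^ 2 / ε) := ⟨_, rfl⟩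
  rw [← hD, ← hτ] at hpen hmx hmy
  rw [← hD] at hD0 hj
  rw [← hG] at hmx hmy
  have hpenG : K * ‖x - y‖ + G + (t - s) ^ 2 / ε = τ * D := by rw [hG]; ring
  have hsub := hu.1.exp_test (i := i) (y := x) (t := t) ht.1 (R + 1)
    (f := fun z => (K * ‖z.1 - y‖ + G + (z.2 - s) ^ 2 / ε) / (z.2 * (T - z.2)))
    (q := q) (b := -((K * ‖x - y‖ + G + (t - s) ^ 2 / ε) * (T - 2 * t) / (t * (T - t)) ^ 2)
        + 2 * (t - s) / ε / (t * (T - t)))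
    (by
      have h1 : ContDiffAt ℝ 1 (fun z : Euc N × ℝ => ‖z.1 - y‖) (x, t) :=
        (contDiffAt_fst.sub contDiffAt_const).norm ℝ (sub_ne_zero.2 hxy)
      have h2 : ContDiffAt ℝ 1 (fun z : Euc N × ℝ => (z.2 - s) ^ 2 / ε) (x, t) := by fun_prop
      have h3 : ContDiffAt ℝ 1 (fun z : Euc N × ℝ => z.2 * (T - z.2)) (x, t) := by fun_prop
      exact (((contDiffAt_const.mul h1).add contDiffAt_const).add h2).div h3
        (by rw [← hτ]; exact hτ0.ne'))
    (by
      have hnb : ∀ᶠ z : Euc N × ℝ in 𝓝 (x, t), z.2 ∈ Ioo 0 T :=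
        continuous_snd.continuousAt.eventually (Ioo_mem_nhds ht.1 ht.2)
      filter_upwards [hnb] with z hz
      have hz' := Ioo_subset_Icc_self hz
      have hτz : 0 < z.2 * (T - z.2) := mul_pos hz.1 (by linarith [hz.2])
      rw [← hlog i z.1 z.2 hz', ← hlog i x t ht', ← Real.exp_add, Real.exp_le_exp, hpenG, ← hτ,
        mul_div_cancel_left₀ _ hτ0.ne']
      have h1 : w i z.1 z.2 - w i y s ≤
          (K * ‖z.1 - y‖ + G + (z.2 - s) ^ 2 / ε) / (z.2 * (T - z.2)) := by
        rw [le_div_iff₀ hτz]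
        linarith [hmx z.1 z.2 hz']
      linarith)
    (hasDerivAt_penalty (k := K * ‖x - y‖ + G) (by rw [← hτ]; exact hτ0.ne'))
    (by
      have h1 := hasGradientAt_add_const (hasGradientAt_const_mul (hasGradientAt_norm_sub hxy)
        (K / τ)) ((G + (t - s) ^ 2 / ε) / τ)
      rw [← hqe] at h1
      refine h1.congr_of_eventuallyEq (Eventually.of_forall fun z => ?_)
      simp only [← hτ]
      ring)
  -- The weight depends on `t` alone and is frozen here, so only the subsolution side sees its
  -- derivative.
  have hsup := hu.2.exp_test (i := i) (y := y) (t := s) hs.1 (R + 1)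
    (f := fun z => -(K / τ) * ‖z.1 - x‖ + -((z.2 - t) ^ 2 / ε / τ))
    (q := q) (b := 2 * (t - s) / ε / (t * (T - t)))
    (by
      have h1 : ContDiffAt ℝ 1 (fun z : Euc N × ℝ => ‖z.1 - x‖) (y, s) :=
        (contDiffAt_fst.sub contDiffAt_const).norm ℝ (sub_ne_zero.2 hxy.symm)
      have h2 : ContDiffAt ℝ 1 (fun z : Euc N × ℝ => -((z.2 - t) ^ 2 / ε / τ)) (y, s) := by
        fun_prop
      exact (contDiffAt_const.mul h1).add h2)
    (by
      have hnb : ∀ᶠ z : Euc N × ℝ in 𝓝 (y, s), z.2 ∈ Ioo 0 T :=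
        continuous_snd.continuousAt.eventually (Ioo_mem_nhds hs.1 hs.2)
      filter_upwards [hnb] with z hz
      have hz' := Ioo_subset_Icc_self hz
      rw [← hlog i z.1 z.2 hz', ← hlog i y s hs', ← Real.exp_add, Real.exp_le_exp]
      have h1 := hmy z.1 z.2 hz'
      rw [hG, hD, norm_sub_rev x z.1, norm_sub_rev x y] at h1
      refine le_of_mul_le_mul_left ?_ hτ0
      have e : τ * (w i y s + (-(K / τ) * ‖z.1 - x‖ + -((z.2 - t) ^ 2 / ε / τ)
          - (-(K / τ) * ‖y - x‖ + -((s - t) ^ 2 / ε / τ)))) =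
          τ * w i y s - (K * ‖z.1 - x‖ + (t - z.2) ^ 2 / ε)
            + (K * ‖y - x‖ + (t - s) ^ 2 / ε) := by
        field_simp
        ring
      rw [e]
      linarith)
    (by
      have h1 := (((((hasDerivAt_id s).sub_const t).pow 2).div_const ε).div_const τ).neg.const_add
        (-(K / τ) * ‖y - x‖)
      refine h1.congr_deriv ?_
      simp only [id, ← hτ]
      ring)
    (by
      have h1 := hasGradientAt_add_const (hasGradientAt_const_mul
        (hasGradientAt_norm_sub hxy.symm) (-(K / τ))) (-((s - t) ^ 2 / ε / τ))
      convert h1 using 1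
      rw [hqe, norm_sub_rev y x, ← neg_sub x y, smul_neg, smul_neg, neg_smul, neg_neg])
  rw [← hv, hHP] at hsub
  rw [← hv', hHP] at hsup
  rw [hpenG, ← hτ] at hsub
  rw [← hτ] at hsup
  have hnx : ‖x‖ ≤ max (N + T ^ 2 * V + 1) R := hx.trans (le_max_left _ _)
  have hny : ‖y‖ ≤ max (N + T ^ 2 * V + 1) R := hy.trans (le_max_left _ _)
  have hRm : R ≤ max (N + T ^ 2 * V + 1) R := le_max_right _ _
  have hn0 : ‖(0 : Euc N)‖ ≤ max (N + T ^ 2 * V + 1) R := by rw [norm_zero]; linarith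
  have hux := (hR x t ht').trans hRm
  have huy := (hR y s hs').trans hRm
  have hudiff : ‖u (proj x) t - u (proj y) s‖ ≤ V * (3 * D) := by
    refine (pi_norm_le_iff_of_nonneg (by positivity)).2 fun j => ?_
    have h1 := hcomp j x t ht'
    have h2 := hcomp j y s hs'
    have h3 := abs_sub_le_mul_abs_log_sub h2.1 h1.1 h1.2 h2.2
    rw [add_sub_add_right_eq_sub] at h3
    rw [Pi.sub_apply, Real.norm_eq_abs]
    refine h3.trans (mul_le_mul_of_nonneg_left ?_ (by linarith))
    have := hj j
    rwa [hw] at this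
  have hslope := slope_le (v := v) (v' := v') (V := V) (D := D) (Q := K / τ) (r := ‖x - y‖)
    (c := c) (A := A) (T := T) (L := L) (g := h i (proj x) (v' • q)) hvb'.1 hvv' hvb.2
    (by rw [hD, hwx, hwy]) hD0 (by linarith) hc0 hA0.le hL0 (norm_nonneg _)
    (by
      rw [div_mul_eq_mul_div, div_le_iff₀ hτ0]
      have : 0 ≤ (t - s) ^ 2 / ε := by positivity
      linarith)
    (by
      have e : τ * D * (T - 2 * t) / τ ^ 2 = (T - 2 * t) * (D / τ) := by field_simp
      rw [e]
      have h1 : (T - 2 * t) * (D / τ) ≤ T * (D / τ) :=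
        mul_le_mul_of_nonneg_right (by linarith [ht.1]) (by positivity)
      have h2 : D / τ ≤ K / τ * D := by
        rw [div_mul_eq_mul_div]
        exact div_le_div_of_nonneg_right (le_mul_of_one_le_left hD0.le hK1) hτ0.le
      have h3 : T * (D / τ) ≤ T * (K / τ * D) := mul_le_mul_of_nonneg_left h2 hT.le
      linarith)
    hsub hsup
    (by
      have := scaling_gap_smul ha (by linarith) (hconv i (proj x)) (fun p => (hq i (proj x) p).1)
        (fun p => (hq i (proj x) p).2) (show 0 < v' by linarith [hvb'.1]) hvv' q
      rwa [hqn, ← hc] at this)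
    (by
      have := hlip i x y (v' • q)
      rwa [norm_smul, Real.norm_of_nonneg (by linarith [hvb'.1]), hqn] at this)
    (by
      rw [hP, hP]
      refine (hL i x y 0 _ _ hnx hny hn0 hux huy).1.trans ?_
      gcongr)
    (by
      rw [hP]
      exact (hL i y y 0 _ _ hny hny hn0 huy huy).2)
  rw [← hB] at hslope
  linarith

/-- The solution is Lipschitz in the space variable, uniformly on compact time intervals. -/
theorem exists_space_lipschitz (hH : StandingAssumptions H) (hA : ModelStructure H)
    (hu : IsViscositySolution H φ u) {t₁ t₂ : ℝ} (h₁ : 0 < t₁) (h₂ : t₁ ≤ t₂) :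
    ∃ κ : ℝ, 0 ≤ κ ∧ ∀ i (x y : Euc N), ∀ t ∈ Icc t₁ t₂,
      |u (proj x) t i - u (proj y) t i| ≤ κ * ‖x - y‖ := by
  -- With final time `t₂ + t₁`, the weight is at least `t₁ * t₁` on `[t₁, t₂]`.
  obtain ⟨R, hR0, hR⟩ := exists_norm_le hu.1.continuousOn (t₂ + t₁)
  obtain ⟨K, hK0, hK⟩ := exists_log_lipschitz hH hA hu (by linarith) hR0 hR
  refine ⟨(2 * R + 1) * (K / (t₁ * t₁)), by positivity, fun i x y t ht => ?_⟩
  have ht' : t ∈ Icc 0 (t₂ + t₁) := ⟨by linarith [ht.1], by linarith [ht.2]⟩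
  have hb : ∀ y, 1 ≤ u (proj y) t i + (R + 1) ∧ u (proj y) t i + (R + 1) ≤ 2 * R + 1 :=
    fun y => by
      have h1 := (norm_le_pi_norm (u (proj y) t) i).trans (hR y t ht')
      rw [Real.norm_eq_abs, abs_le] at h1
      constructor <;> linarith [h1.1, h1.2]
  have hlog : ∀ x y : Euc N,
      Real.log (u (proj x) t i + (R + 1)) - Real.log (u (proj y) t i + (R + 1)) ≤
        K / (t₁ * t₁) * ‖x - y‖ := fun x y => by
    have hτ : t₁ * t₁ ≤ t * (t₂ + t₁ - t) :=
      mul_le_mul ht.1 (by linarith [ht.2]) h₁.le (by linarith [ht.1])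
    have hτ0 : 0 < t₁ * t₁ := by positivity
    have h1 := hK i x y t ht'
    rw [mul_comm, ← le_div_iff₀ (by linarith)] at h1
    refine h1.trans ?_
    rw [div_mul_eq_mul_div]
    exact div_le_div_of_nonneg_left (by positivity) hτ0 hτ
  have h3 := abs_sub_le_mul_abs_log_sub (hb y).1 (hb x).1 (hb x).2 (hb y).2
  rw [add_sub_add_right_eq_sub] at h3
  refine h3.trans ?_
  rw [mul_assoc]
  refine mul_le_mul_of_nonneg_left (abs_le.2 ⟨?_, hlog x y⟩) (by linarith)
  have := hlog y x
  rw [norm_sub_rev] at this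
  linarith

/-! ### Lipschitz estimate in time -/

/-- A function that is Lipschitz in space and that cannot be touched from above by paraboloids
of speed `C` and bounded slope grows at speed at most `C`. -/
theorem le_add_of_not_isLocalMax {g : Euc N → ℝ → ℝ} {x₀ : Euc N} {s₀ R κ C : ℝ} (hκ0 : 0 ≤ κ)
    (hc : ContinuousOn (fun z : Euc N × ℝ => g z.1 z.2) (univ ×ˢ Icc s₀ (s₀ + 1)))
    (hR : ∀ x, ∀ t ∈ Icc s₀ (s₀ + 1), |g x t| ≤ R) (hRC : 2 * R < C)
    (hκ : ∀ x y, ∀ t ∈ Icc s₀ (s₀ + 1), |g x t - g y t| ≤ κ * ‖x - y‖)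
    (hno : ∀ k : ℝ, ∀ x, ∀ t ∈ Ioo s₀ (s₀ + 1), ‖(2 * k) • (x - x₀)‖ ≤ 2 * κ →
      ¬ IsLocalMax (fun z : Euc N × ℝ => g z.1 z.2 - (C * (z.2 - s₀) + k * ‖z.1 - x₀‖ ^ 2)) (x, t))
    {t : ℝ} (ht : t ∈ Icc s₀ (s₀ + 1)) : g x₀ t ≤ g x₀ s₀ + C * (t - s₀) := by
  refine le_of_forall_pos_le_add fun e he => ?_
  -- A steep paraboloid makes the error at the initial time at most `κ ^ 2 / k ≤ e`. Also `k ≥ 1`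
  -- keeps the maximum point within `κ` of `x₀`, inside the ball of radius `κ + 1`.
  obtain ⟨k, hk⟩ : ∃ k : ℝ, k = 1 + κ ^ 2 / e := ⟨_, rfl⟩
  have hk1 : 1 ≤ k := by rw [hk]; linarith [show 0 ≤ κ ^ 2 / e by positivity]
  have hke : κ ^ 2 ≤ k * e := by
    have : κ ^ 2 / e * e = κ ^ 2 := by field_simp
    rw [hk, add_mul, this]
    linarith
  have hk0 : 0 < k := by linarith
  have hs₀ : s₀ ∈ Icc s₀ (s₀ + 1) := ⟨le_rfl, by linarith⟩
  let F : Euc N × ℝ → ℝ := fun z => g z.1 z.2 - (C * (z.2 - s₀) + k * ‖z.1 - x₀‖ ^ 2)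
  have hS : IsCompact (Metric.closedBall x₀ (κ + 1) ×ˢ Icc s₀ (s₀ + 1)) :=
    (isCompact_closedBall _ _).prod isCompact_Icc
  have hx₀ : x₀ ∈ Metric.closedBall x₀ (κ + 1) := Metric.mem_closedBall_self (by linarith)
  have hF : ContinuousOn F (Metric.closedBall x₀ (κ + 1) ×ˢ Icc s₀ (s₀ + 1)) := by
    have h1 : Continuous fun z : Euc N × ℝ => C * (z.2 - s₀) + k * ‖z.1 - x₀‖ ^ 2 := by
      fun_prop
    exact (hc.mono (prod_mono (subset_univ _) subset_rfl)).sub h1.continuousOn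
  obtain ⟨⟨x, τ⟩, ⟨hx, hτ⟩, hmax⟩ := hS.exists_isMaxOn ⟨(x₀, s₀), hx₀, hs₀⟩ hF
  dsimp only at hx hτ
  have hxτ := hmax (mk_mem_prod hx₀ hτ)
  have hxt := hmax (mk_mem_prod hx₀ ht)
  have hxs := hmax (mk_mem_prod hx₀ hs₀)
  simp only [F, mem_ofPred_eq, sub_self, norm_zero] at hxτ hxt hxs
  have hslope : k * ‖x - x₀‖ ≤ κ := by
    by_contra! hcon
    have hpos : 0 < ‖x - x₀‖ := by
      refine (norm_nonneg _).lt_of_ne' fun h => ?_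
      rw [h] at hcon
      linarith
    have h1 := (abs_le.1 (hκ x x₀ τ hτ)).2
    nlinarith
  rcases hτ.1.eq_or_lt with rfl | hlt
  -- A maximum at the initial time is harmless: this is where the error `e` is spent.
  · have h1 := (abs_le.1 (hκ x x₀ s₀ hs₀)).2
    have h2 : κ * ‖x - x₀‖ ≤ e := by
      refine le_of_mul_le_mul_left ?_ hk0
      nlinarith
    have h3 : 0 ≤ k * ‖x - x₀‖ ^ 2 := by positivity
    linarith
  -- The final time is excluded because over unit time the barrier rises by `C > 2 * R`, more than
  -- `g` can.
  · have hgt : τ < s₀ + 1 := by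
      refine lt_of_le_of_ne hτ.2 fun h => ?_
      have h1 := (abs_le.1 (hR x τ hτ)).2
      have h2 := (abs_le.1 (hR x₀ s₀ hs₀)).1
      have h3 : 0 ≤ k * ‖x - x₀‖ ^ 2 := by positivity
      rw [h] at h1 hxs
      linarith
    have hxκ : ‖x - x₀‖ ≤ κ := (le_mul_of_one_le_left (norm_nonneg _) hk1).trans hslope
    refine absurd ?_ (hno k x τ ⟨hlt, hgt⟩ ?_)
    · refine hmax.isLocalMax (prod_mem_nhds ?_ (Icc_mem_nhds hlt hgt))
      refine Filter.mem_of_superset (Metric.isOpen_ball.mem_nhds ?_) Metric.ball_subset_closedBall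
      rw [Metric.mem_ball, dist_eq_norm]
      linarith
    · rw [norm_smul, Real.norm_of_nonneg (by linarith)]
      linarith

theorem contDiffAt_paraboloid (c C k s₀ : ℝ) (x₀ : Euc N) (z : Euc N × ℝ) :
    ContDiffAt ℝ 1 (fun z : Euc N × ℝ => c * (C * (z.2 - s₀) + k * ‖z.1 - x₀‖ ^ 2)) z := by
  have h : ContDiff ℝ 1 fun z : Euc N × ℝ => ‖z.1 - x₀‖ ^ 2 :=
    (contDiff_fst.sub contDiff_const).norm_sq ℝ
  fun_prop

theorem hasDerivAt_paraboloid (c C k s₀ t : ℝ) (x x₀ : Euc N) :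
    HasDerivAt (fun s => c * (C * (s - s₀) + k * ‖x - x₀‖ ^ 2)) (c * C) t := by
  simpa using ((((hasDerivAt_id t).sub_const s₀).const_mul C).add_const
    (k * ‖x - x₀‖ ^ 2)).const_mul c

theorem hasGradientAt_paraboloid (c C k s₀ t : ℝ) (x x₀ : Euc N) :
    HasGradientAt (fun z => c * (C * (t - s₀) + k * ‖z - x₀‖ ^ 2))
      (c • (2 * k) • (x - x₀)) x := by
  have h := hasGradientAt_const_mul (hasGradientAt_add_const (hasGradientAt_const_mul
    (hasGradientAt_norm_sub_sq x x₀) k) (C * (t - s₀))) c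
  rw [smul_smul k, mul_comm k] at h
  simpa only [add_comm] using h

/-- The solution is Lipschitz in time, uniformly on compact time intervals. -/
theorem exists_time_lipschitz (hH : StandingAssumptions H) (hA : ModelStructure H)
    (hu : IsViscositySolution H φ u) {t₁ t₂ : ℝ} (h₁ : 0 < t₁) (h₂ : t₁ ≤ t₂) :
    ∃ C : ℝ, 0 ≤ C ∧ ∀ i (x : Euc N) (s t : ℝ), t₁ ≤ s → s ≤ t → t ≤ s + 1 → s + 1 ≤ t₂ →
      |u (proj x) t i - u (proj x) s i| ≤ C * (t - s) := by
  obtain ⟨R, hR0, hR⟩ := exists_norm_le hu.1.continuousOn t₂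
  obtain ⟨κ, hκ0, hκ⟩ := exists_space_lipschitz hH hA hu h₁ h₂
  obtain ⟨L, hL0, hL⟩ := hH.exists_bound (max (max (N : ℝ) R) (2 * κ))
  have hHL : ∀ i (x p : Euc N) b, ‖p‖ ≤ 2 * κ → ‖b‖ ≤ R → |H i (proj x) p b| ≤ L := by
    intro i x p b hp hb
    obtain ⟨k, hk, hx⟩ := exists_mem_integerLattice_norm_add_le x
    rw [← proj_add_of_mem hk]
    have hx' : ‖x + k‖ ≤ max (max (N : ℝ) R) (2 * κ) :=
      hx.trans ((le_max_left _ _).trans (le_max_left _ _))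
    have hb' : ‖b‖ ≤ max (max (N : ℝ) R) (2 * κ) :=
      hb.trans ((le_max_right _ _).trans (le_max_left _ _))
    exact (hL i _ (x + k) p b b hx' hx' (hp.trans (le_max_right _ _)) hb' hb').2
  -- The speed exceeds both `L`, contradicting the equation at a touching point, and `2 * R`,
  -- excluding contact at the final time.
  refine ⟨2 * R + L + 1, by linarith, fun i x₀ s₀ t hs hst hts hs' => ?_⟩
  have hsub : Icc s₀ (s₀ + 1) ⊆ Icc t₁ t₂ := Icc_subset_Icc hs hs'
  have hsub0 : Icc s₀ (s₀ + 1) ⊆ Icc 0 t₂ := Icc_subset_Icc (by linarith) hs'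
  have hcont : ContinuousOn (fun z : Euc N × ℝ => u (proj z.1) z.2 i)
      (univ ×ˢ Icc s₀ (s₀ + 1)) :=
    (continuousOn_pi.1 (continuousOn_lift hu.1.continuousOn) i).mono
      (prod_mono subset_rfl fun r hr => (hsub0 hr).1)
  have hRi : ∀ x : Euc N, ∀ t ∈ Icc s₀ (s₀ + 1), |u (proj x) t i| ≤ R := fun x t ht =>
    (norm_le_pi_norm (u (proj x) t) i).trans (hR x t (hsub0 ht))
  have hup := le_add_of_not_isLocalMax (g := fun x t => u (proj x) t i) (x₀ := x₀)
    (C := 2 * R + L + 1) hκ0 hcont hRi (by linarith) (fun x y t ht => hκ i x y t (hsub ht))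
    (fun k x r hr hp hmax => by
      have hr' := Ioo_subset_Icc_self hr
      have h := hu.1.sub i x r (by linarith [hr.1]) _
        (contDiffAt_paraboloid 1 (2 * R + L + 1) k s₀ x₀ (x, r)) (by simpa using hmax)
      rw [(hasDerivAt_paraboloid _ _ _ _ _ _ _).deriv,
        (hasGradientAt_paraboloid _ _ _ _ _ _ _).gradient, one_smul] at h
      have := (abs_le.1 (hHL i x _ _ hp (hR x r (hsub0 hr')))).1
      linarith) ⟨hst, hts⟩
  have hlow := le_add_of_not_isLocalMax (g := fun x t => -u (proj x) t i) (x₀ := x₀)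
    (C := 2 * R + L + 1) hκ0 hcont.neg (fun x t ht => by rw [abs_neg]; exact hRi x t ht)
    (by linarith)
    (fun x y t ht => by
      rw [← neg_sub', abs_neg]
      exact hκ i x y t (hsub ht))
    (fun k x r hr hp hmax => by
      have hr' := Ioo_subset_Icc_self hr
      have h := hu.2.super i x r (by linarith [hr.1]) _
        (contDiffAt_paraboloid (-1) (2 * R + L + 1) k s₀ x₀ (x, r)) (by
          have := hmax.neg
          refine this.congr (Eventually.of_forall fun z => ?_)
          dsimp only
          ring)
      rw [(hasDerivAt_paraboloid _ _ _ _ _ _ _).deriv,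
        (hasGradientAt_paraboloid _ _ _ _ _ _ _).gradient] at h
      have := (abs_le.1 (hHL i x ((-1 : ℝ) • (2 * k) • (x - x₀)) _
        (by rwa [neg_smul, one_smul, norm_neg]) (hR x r (hsub0 hr')))).2
      linarith) ⟨hst, hts⟩
  exact abs_le.2 ⟨by linarith, by linarith⟩

/-! ### From the covering space to the torus -/

/-- The quotient distance is an infimum over lifts, so almost optimal lifts suffice to transfer a
Lipschitz bound. -/
theorem exists_lift_norm_sub_lt (x y : Torus N) {e : ℝ} (he : 0 < e) :
    ∃ a b : Euc N, proj a = x ∧ proj b = y ∧ ‖a - b‖ < dist x y + e := by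
  obtain ⟨a, rfl⟩ := QuotientAddGroup.mk_surjective x
  obtain ⟨d, hd, hdn⟩ := QuotientAddGroup.exists_norm_mk_lt ((a : Torus N) - y) he
  refine ⟨a, a - d, rfl, ?_, by rwa [sub_sub_cancel, dist_eq_norm]⟩
  unfold proj
  rw [QuotientAddGroup.mk_sub, hd, sub_sub_cancel]

end WeaklyCoupledHJ

theorem theorem1p2 {N m : ℕ} (hN : 0 < N) (hm : 0 < m)
    (H : WeaklyCoupledHJ.Hamiltonians N m)
    (hH : WeaklyCoupledHJ.StandingAssumptions H)
    (hA : WeaklyCoupledHJ.ModelStructure H)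
    (φ : WeaklyCoupledHJ.Torus N → Fin m → ℝ) (hφ : Continuous φ)
    (u : WeaklyCoupledHJ.Torus N → ℝ → Fin m → ℝ)
    (hu : WeaklyCoupledHJ.IsViscositySolution H φ u) :
    WeaklyCoupledHJ.IsLocallyLipschitz u := by
  intro x₀ t₀ ht₀
  obtain ⟨κ, hκ0, hκ⟩ := WeaklyCoupledHJ.exists_space_lipschitz hH hA hu
    (t₁ := t₀ / 2) (t₂ := 2 * t₀ + 2) (by linarith) (by linarith)
  obtain ⟨C, hC0, hC⟩ := WeaklyCoupledHJ.exists_time_lipschitz hH hA hu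
    (t₁ := t₀ / 2) (t₂ := 2 * t₀ + 2) (by linarith) (by linarith)
  -- The radius keeps times above `t₀ / 2` and within unit distance of each other, as the time
  -- estimate requires.
  refine ⟨min (t₀ / 2) (1 / 2), κ + C + 1, lt_min (by linarith) (by norm_num), by linarith, ?_⟩
  intro x y t s _ _ hxt hys
  have ht : |t - t₀| < min (t₀ / 2) (1 / 2) := by linarith [dist_nonneg (x := x) (y := x₀)]
  have hs : |s - t₀| < min (t₀ / 2) (1 / 2) := by linarith [dist_nonneg (x := y) (y := x₀)]
  have ht1 := abs_lt.1 (ht.trans_le (min_le_left _ _))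
  have ht2 := abs_lt.1 (ht.trans_le (min_le_right _ _))
  have hs1 := abs_lt.1 (hs.trans_le (min_le_left _ _))
  have hs2 := abs_lt.1 (hs.trans_le (min_le_right _ _))
  have hd : 0 ≤ dist x y := dist_nonneg
  refine (pi_norm_le_iff_of_nonneg (by positivity)).2 fun i => ?_
  have hspace : |u x t i - u y t i| ≤ κ * dist x y := by
    refine le_of_forall_pos_le_add fun e he => ?_
    obtain ⟨a, b, rfl, rfl, hab⟩ := WeaklyCoupledHJ.exists_lift_norm_sub_lt x y
      (show 0 < e / (κ + 1) by positivity)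
    refine (hκ i a b t ⟨by linarith [ht1.1], by linarith [ht1.2]⟩).trans ?_
    have h1 := mul_le_mul_of_nonneg_left hab.le hκ0
    have h2 : κ * (e / (κ + 1)) ≤ e := by
      rw [← mul_div_assoc, div_le_iff₀ (by linarith)]
      linarith
    linarith
  have htime : |u y t i - u y s i| ≤ C * |t - s| := by
    obtain ⟨b, rfl⟩ := QuotientAddGroup.mk_surjective y
    rcases le_total s t with h | h
    · rw [abs_of_nonneg (sub_nonneg.2 h)]
      exact hC i b s t (by linarith [hs1.1]) h (by linarith [ht2.2, hs2.1])
        (by linarith [hs1.2])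
    · rw [abs_sub_comm, abs_sub_comm t s, abs_of_nonneg (sub_nonneg.2 h)]
      exact hC i b t s (by linarith [ht1.1]) h (by linarith [hs2.2, ht2.1])
        (by linarith [ht1.2])
  rw [Pi.sub_apply, Real.norm_eq_abs]
  have h3 := abs_sub_le (u x t i) (u y t i) (u y s i)
  have h4 : 0 ≤ κ * |t - s| := by positivity
  have h5 : 0 ≤ C * dist x y := by positivity
  have h6 : (κ + C + 1) * (dist x y + |t - s|) =
    κ * dist x y + C * |t - s| + κ * |t - s| + C * dist x y + dist x y + |t - s| := by ring
  linarith [abs_nonneg (t - s)]
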